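/- **Theorem.** Let $\Gamma$ be a finitely presented group with a finite generating set $S$, and assume that $\Gamma$ has Kazhdan's property (T). Representations are by bounded invertible operators. For a representation $\pi$ of $\Gamma$ on a complex Hilbert space $E$ and $\varepsilon>0$, an $\varepsilon$-deformation of $\pi$ is a representation $\rho$ of $\Gamma$ on the same space $E$, by bounded invertible linear operators (not necessarily unitary or uniformly bounded), such that $\sup_{s\in S}\|\pi_s-\rho_s\|\le\varepsilon$ in operator norm. We say that $H^2(\Gamma,\pi)$ is reduced if the space of 2-coboundaries is closed in the space of 2-cocycles (for the topology of pointwise convergence on cochains $\Gamma\times\Gamma\to E$), that is, if $H^2(\Gamma,\pi)$ equals the reduced cohomology $\overline{H}^2(\Gamma,\pi)$. An affine action with linear part $\rho$ is an action of $\Gamma$ on $E$ of the form $v\mapsto\rho_g v+b(g)$. 1. For every unitary representation $\pi$ of $\Gamma$ such that $H^2(\Gamma,\pi)$ is reduced there exists $\varepsilon=\varepsilon(\Gamma,S,\pi)>0$ such that for every $\varepsilon$-deformation $\rho$ of $\pi$, every affine action of $\Gamma$ with linear part $\rho$ (in particular, every isometric one) has a fixed point. 2. If $H^2(\Gamma,\pi)$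 is reduced for every unitary representation $\pi$ of $\Gamma$, then $\varepsilon$ in (1) can be chosen independently of $\pi$: there exists $\varepsilon=\varepsilon(\Gamma,S)>0$ such that for every unitary representation $\pi$ of $\Gamma$ and every $\varepsilon$-deformation $\rho$ of $\pi$, every affine action of $\Gamma$ with linear part $\rho$ has a fixed point. -/

import Mathlib

/-!
Representations of a discrete group `Γ` on a Banach space `E` are homomorphisms
`Γ →* (E →L[ℂ] E)`; as `Γ` is a group, every operator in the image is invertible with bounded
inverse.
-/

universe u v

namespace DeformT

section Cohomology

variable {Γ : Type v} [Group Γ] {E : Type u} [NormedAddCommGroup E] [NormedSpace ℂ E]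

/-- The coboundary `C¹(Γ, π) → C²(Γ, π)` of the standard (inhomogeneous) complex:
`(d¹ b)(g, h) = π(g) b(h) - b(gh) + b(g)`. -/
def d1 (π : Γ →* (E →L[ℂ] E)) : (Γ → E) →ₗ[ℂ] (Γ × Γ → E) where
  toFun b := fun p => π p.1 (b p.2) - b (p.1 * p.2) + b p.1
  map_add' b c := by
    funext p
    simp only [Pi.add_apply, map_add]
    abel
  map_smul' a b := by
    funext p
    simp only [Pi.smul_apply, map_smul, RingHom.id_apply, smul_add, smul_sub]

/-- The coboundary `C²(Γ, π) → C³(Γ, π)` of the standard (inhomogeneous) complex: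
`(d² c)(g, h, k) = π(g) c(h, k) - c(gh, k) + c(g, hk) - c(g, h)`. -/
def d2 (π : Γ →* (E →L[ℂ] E)) : (Γ × Γ → E) →ₗ[ℂ] (Γ × Γ × Γ → E) where
  toFun c := fun p =>
    π p.1 (c (p.2.1, p.2.2)) - c (p.1 * p.2.1, p.2.2) + c (p.1, p.2.1 * p.2.2) - c (p.1, p.2.1)
  map_add' b c := by
    funext p
    simp only [Pi.add_apply, map_add]
    abel
  map_smul' a b := by
    funext p
    simp only [Pi.smul_apply, map_smul, RingHom.id_apply, smul_add, smul_sub]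

/-- The space `Z²(Γ, π)` of 2-cocycles. -/
def twoCocycles (π : Γ →* (E →L[ℂ] E)) : Submodule ℂ (Γ × Γ → E) :=
  LinearMap.ker (d2 π)

/-- The space `B²(Γ, π)` of 2-coboundaries. -/
def twoCoboundaries (π : Γ →* (E →L[ℂ] E)) : Submodule ℂ (Γ × Γ → E) :=
  LinearMap.range (d1 π)

theorem twoCoboundaries_le_twoCocycles (π : Γ →* (E →L[ℂ] E)) :
    twoCoboundaries π ≤ twoCocycles π := by
  rintro _ ⟨b, rfl⟩
  refine LinearMap.mem_ker.mpr ?_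
  funext p
  have h : π (p.1 * p.2.1) (b p.2.2) = π p.1 (π p.2.1 (b p.2.2)) := by
    rw [map_mul]
    rfl
  simp only [d1, d2, LinearMap.coe_mk, AddHom.coe_mk, map_add, map_sub, h, mul_assoc,
    Pi.zero_apply]
  abel

/-- `H²(Γ, π) = Z²(Γ, π) / B²(Γ, π)` is reduced, i.e. it coincides with
`Z²(Γ, π) / closure B²(Γ, π)`: the coboundaries are closed in the space of cocycles, where cochains
carry the topology of pointwise convergence (the product topology on `Γ × Γ → E`). -/
def H2IsReduced (π : Γ →* (E →L[ℂ] E)) : Prop :=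
  closure {z : twoCocycles π | (z : Γ × Γ → E) ∈ twoCoboundaries π} =
    {z : twoCocycles π | (z : Γ × Γ → E) ∈ twoCoboundaries π}

/-- `ρ` is an `ε`-deformation of `π` with respect to `S`:
`‖π_s - ρ_s‖ ≤ ε` in operator norm for all `s ∈ S`. -/
def IsDeformation (S : Set Γ) (ε : ℝ) (π ρ : Γ →* (E →L[ℂ] E)) : Prop :=
  ∀ s ∈ S, ‖π s - ρ s‖ ≤ ε

/-- The affine action `α` of `Γ` on `E` has linear part `ρ`. -/
def HasLinearPart (α : Γ →* (E ≃ᵃ[ℂ] E)) (ρ : Γ →* (E →L[ℂ] E)) : Prop :=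
  ∀ (g : Γ) (v : E), (α g).linear v = ρ g v

/-- The affine action `α` has a (global) fixed point. -/
def HasFixedPoint (α : Γ →* (E ≃ᵃ[ℂ] E)) : Prop :=
  ∃ x : E, ∀ g : Γ, α g x = x

end Cohomology

/-- `π` is a unitary representation on a complex Hilbert space. -/
def IsUnitaryRep {Γ : Type v} [Group Γ] {E : Type u} [NormedAddCommGroup E]
    [InnerProductSpace ℂ E] [CompleteSpace E] (π : Γ →* (E →L[ℂ] E)) : Prop :=
  ∀ g : Γ, π g ∈ unitary (E →L[ℂ] E)

/-- Kazhdan's property (T) of a discrete group: there are a finite set `Q` and `κ > 0` such that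
every unitary representation with a nonzero `(Q, κ)`-invariant vector has a nonzero invariant
vector. -/
def HasPropertyT (Γ : Type v) [Group Γ] : Prop :=
  ∃ Q : Finset Γ, ∃ κ : ℝ, 0 < κ ∧
    ∀ (E : Type u) [NormedAddCommGroup E] [InnerProductSpace ℂ E] [CompleteSpace E]
      (π : Γ →* (E →L[ℂ] E)), IsUnitaryRep π →
      (∃ v : E, v ≠ 0 ∧ ∀ s ∈ Q, ‖π s v - v‖ < κ * ‖v‖) →
      ∃ w : E, w ≠ 0 ∧ ∀ g : Γ, π g w = w

end DeformT

-- The vanishing of first cohomology is reduced to a condition on finitely many operators, which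
-- survives small perturbations.
--
-- Choose a finite set `T` in Γ whose internal products present Γ (`exists_presents`), and restrict
-- cochains to `T`. This gives a complex of Hilbert spaces E → E^T → E^P, where P consists of the
-- pairs in `T` with product in `T`. A cocycle on `T` extends to Γ because `T` presents Γ
-- (`Presents.exists_cocycle`), and property (T) makes it a coboundary
-- (`HasPropertyT.exists_fixed_of_cocycle`), so the complex is exact in the middle. Reducedness of
-- H² makes the range of the second map closed (`Presents.exists_d1_eq_of_tendsto`). By the open
-- mapping theorem these two facts yield a lower bound c‖x‖ ≤ ‖d₀* x‖ + ‖d₁ x‖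
-- (`exists_gap_of_exact`).
--
-- The bound survives, with c/2, when d₀ and d₁ move by at most c/4, and then the perturbed complex
-- is exact too (`exact_of_gap`). A deformation small on `S` is small on the finite set `T`, so the
-- translation part of an affine action with linear part ρ is a coboundary on `T`, that is, the
-- action has a fixed point. No uniform bound on ρ is needed.
--
-- For part 2, the resulting ε depends on π only through c. If c could not be uniform, the Hilbert
-- sum of representations with gaps tending to 0 would be a unitary representation without a gap
-- (`exists_uniform_hasGap`).

universe w

namespace DeformT

/-! ### Positive semidefinite kernels and their feature maps -/

section Kernel

open scoped ComplexOrder InnerProductSpace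
open Filter Topology Matrix

variable {X : Type u}

theorem posSemidef_gram {E : Type*} [SeminormedAddCommGroup E] [InnerProductSpace ℂ E]
    (v : X → E) : (Matrix.gram ℂ v).PosSemidef := by
  refine ⟨Matrix.isHermitian_gram ℂ v, fun x => ?_⟩
  have h : (x.sum fun i xi => x.sum fun j xj => star xi * Matrix.gram ℂ v i j * xj) =
      ⟪x.sum fun i xi => xi • v i, x.sum fun i xi => xi • v i⟫_ℂ := by
    simp only [Finsupp.sum, sum_inner, inner_smul_left, Matrix.gram_apply]
    refine Finset.sum_congr rfl fun i _ => ?_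
    rw [inner_sum, Finset.mul_sum]
    refine Finset.sum_congr rfl fun j _ => ?_
    rw [inner_smul_right, RCLike.star_def]
    ring
  rw [h, Complex.le_def]
  exact ⟨inner_self_nonneg (𝕜 := ℂ), (inner_self_im (𝕜 := ℂ) _).symm⟩

theorem posSemidef_of_tendsto {A : ℕ → Matrix X X ℂ} {B : Matrix X X ℂ}
    (hA : ∀ n, (A n).PosSemidef) (h : ∀ i j, Tendsto (fun n => A n i j) atTop (𝓝 (B i j))) :
    B.PosSemidef := by
  refine ⟨?_, fun x => ?_⟩
  · ext i j
    have h1 : Tendsto (fun n => star (A n j i)) atTop (𝓝 (star (B j i))) :=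
      (continuous_star.tendsto _).comp (h j i)
    have h2 : (fun n => star (A n j i)) = fun n => A n i j :=
      funext fun n => (hA n).isHermitian.apply i j
    rw [h2] at h1
    exact tendsto_nhds_unique h1 (h i j)
  · refine ge_of_tendsto' (x := atTop) (f := fun n =>
      x.sum fun i xi => x.sum fun j xj => star xi * A n i j * xj) ?_ fun n => (hA n).2 x
    exact tendsto_finsetSum _ fun i _ => tendsto_finsetSum _ fun j _ =>
      ((h i j).const_mul _).mul_const _

theorem posSemidef_map_pow {A : Matrix X X ℂ} (hA : A.PosSemidef) (n : ℕ) :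
    (A.map (· ^ n)).PosSemidef := by
  induction n with
  | zero =>
    have h : A.map (· ^ 0) = Matrix.gram ℂ (fun _ : X => (1 : ℂ)) := by
      ext i j
      simp
    exact h ▸ posSemidef_gram _
  | succ n ih =>
    have h : A.map (· ^ (n + 1)) = A.map (· ^ n) ⊙ A := by
      ext i j
      simp [pow_succ]
    exact h ▸ ih.hadamard hA

/-- The exponential series has nonnegative coefficients, and entrywise powers are positive
semidefinite by the Schur product theorem. -/
theorem posSemidef_map_exp {A : Matrix X X ℂ} (hA : A.PosSemidef) :
    (A.map Complex.exp).PosSemidef := by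
  refine posSemidef_of_tendsto
    (A := fun n => ∑ k ∈ Finset.range n, ((k.factorial : ℂ)⁻¹) • A.map (· ^ k))
    (fun n => Matrix.posSemidef_sum _ fun k _ => ?_) fun i j => ?_
  · refine (posSemidef_map_pow hA k).smul ?_
    simp
  · have h := (NormedSpace.expSeries_div_hasSum_exp (A i j)).tendsto_sum_nat
    rw [← Complex.exp_eq_exp_ℂ] at h
    simpa [Matrix.sum_apply, div_eq_inv_mul] using h

/-- The Gaussian kernel `exp(-t‖x - y‖²)` on a Hilbert space is positive semidefinite. -/
theorem posSemidef_gaussian {E : Type u} [NormedAddCommGroup E] [InnerProductSpace ℂ E]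
    {t : ℝ} (ht : 0 ≤ t) :
    (Matrix.of fun x y : E => (Real.exp (-t * ‖x - y‖ ^ 2) : ℂ)).PosSemidef := by
  -- The Gaussian factors as exp(2t Re⟪x, y⟫) times the rank-one kernel exp(-t‖x‖²) exp(-t‖y‖²);
  -- this is the exponent of the first factor.
  have h1 : ((t : ℂ) • (Matrix.gram ℂ (id : E → E) + (Matrix.gram ℂ (id : E → E))ᵀ)).PosSemidef :=
    ((posSemidef_gram _).add (posSemidef_gram _).transpose).smul (by exact_mod_cast ht)
  have h2 := (posSemidef_map_exp h1).hadamard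
    (posSemidef_gram fun x : E => (Real.exp (-t * ‖x‖ ^ 2) : ℂ))
  refine Eq.mp (congrArg Matrix.PosSemidef ?_) h2
  ext x y
  have h3 : ⟪x, y⟫_ℂ + ⟪y, x⟫_ℂ = ((2 * RCLike.re ⟪x, y⟫_ℂ : ℝ) : ℂ) := by
    rw [← inner_conj_symm y x, RCLike.add_conj]
    norm_num
  simp only [Matrix.of_apply, Matrix.hadamard_apply, Matrix.map_apply, Matrix.smul_apply,
    Matrix.add_apply, Matrix.transpose_apply, Matrix.gram_apply, id, smul_eq_mul, h3,
    RCLike.inner_apply, Complex.conj_ofReal]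
  rw [← Complex.ofReal_mul t, ← Complex.ofReal_exp, ← Complex.ofReal_mul, ← Complex.ofReal_mul,
    ← Real.exp_add, ← Real.exp_add, @norm_sub_sq ℂ]
  congr 2
  ring

/-- Every positive semidefinite kernel is the Gram kernel of a total family in a Hilbert space. -/
theorem exists_feature_map {K : Matrix X X ℂ} (hK : K.PosSemidef) :
    ∃ (H : Type u) (_ : NormedAddCommGroup H) (_ : InnerProductSpace ℂ H) (_ : CompleteSpace H)
      (φ : X → H), (∀ x y, ⟪φ x, φ y⟫_ℂ = K x y) ∧
        DenseRange (Finsupp.linearCombination ℂ φ) := by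
  -- The form may be degenerate; the completion of the seminormed space also separates, killing the
  -- null vectors.
  let c : PreInnerProductSpace.Core ℂ (X →₀ ℂ) :=
    { inner := fun f g => f.sum fun x z => g.sum fun y w => star z * K x y * w
      conj_inner_symm := fun f g => by
        rw [Finsupp.sum_comm]
        simp only [map_finsuppSum]
        refine Finsupp.sum_congr fun x _ => Finsupp.sum_congr fun y _ => ?_
        rw [← hK.isHermitian.apply y x]
        simp only [RCLike.star_def, map_mul, RCLike.conj_conj]
        ring
      add_left := fun f g h => by
        rw [Finsupp.sum_add_index'] <;> simp [← Finsupp.sum_add, add_mul]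
      smul_left := fun f g z => by
        rw [Finsupp.sum_smul_index] <;> simp [Finsupp.mul_sum, ← mul_assoc]
      re_inner_nonneg := fun f => (Complex.le_def.1 (hK.2 f)).1 }
  let _ : SeminormedAddCommGroup (X →₀ ℂ) := InnerProductSpace.Core.toSeminormedAddCommGroup (c := c)
  let _ : InnerProductSpace ℂ (X →₀ ℂ) := InnerProductSpace.ofCore c
  refine ⟨UniformSpace.Completion (X →₀ ℂ), inferInstance, inferInstance, inferInstance,
    fun x => ((Finsupp.single x 1 : X →₀ ℂ) : UniformSpace.Completion (X →₀ ℂ)),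
    fun x y => ?_, ?_⟩
  · rw [UniformSpace.Completion.inner_coe]
    change ((Finsupp.single x (1 : ℂ)).sum fun x z => (Finsupp.single y (1 : ℂ)).sum
      fun y w => star z * K x y * w) = _
    simp
  · convert UniformSpace.Completion.denseRange_coe (α := X →₀ ℂ) using 1
    funext f
    rw [Finsupp.linearCombination_apply]
    conv_rhs => rw [← Finsupp.sum_single f]
    simp only [Finsupp.sum]
    rw [← UniformSpace.Completion.coe_toComplₗᵢ (𝕜 := ℂ), map_sum]
    refine Finset.sum_congr rfl fun i _ => ?_
    rw [← map_smul]
    simp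

end Kernel

/-! ### Unitary representations: almost invariant vectors, extension, bounded cocycles -/

section Unitary

open scoped InnerProductSpace

variable {Γ : Type v} [Group Γ] {E : Type u} [NormedAddCommGroup E]

theorem map_mul_apply [NormedSpace ℂ E] (π : Γ →* (E →L[ℂ] E)) (g h : Γ) (x : E) :
    π (g * h) x = π g (π h x) := by
  rw [map_mul]
  rfl

theorem map_apply_map_inv_apply [NormedSpace ℂ E] (π : Γ →* (E →L[ℂ] E)) (g : Γ) (x : E) :
    π g (π g⁻¹ x) = x := by
  rw [← map_mul_apply, mul_inv_cancel, map_one]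
  rfl

/-- The invariant vectors of a representation. -/
def invariants [NormedSpace ℂ E] (π : Γ →* (E →L[ℂ] E)) : Submodule ℂ E where
  carrier := {x | ∀ g, π g x = x}
  add_mem' hx hy g := by rw [map_add, hx g, hy g]
  zero_mem' g := map_zero _
  smul_mem' a x hx g := by rw [map_smul, hx g]

theorem isClosed_invariants [NormedSpace ℂ E] (π : Γ →* (E →L[ℂ] E)) : IsClosed (invariants π : Set E) := by
  have h : (invariants π : Set E) = ⋂ g, {x | π g x = x} := by
    ext x
    simp [invariants]
  rw [h]
  exact isClosed_iInter fun g => isClosed_eq (π g).continuous continuous_id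

variable [InnerProductSpace ℂ E] [CompleteSpace E] {π : Γ →* (E →L[ℂ] E)}

theorem IsUnitaryRep.norm_map (hπ : IsUnitaryRep π) (g : Γ) (x : E) : ‖π g x‖ = ‖x‖ :=
  (ContinuousLinearMap.norm_map_iff_adjoint_comp_self (π g)).2
    (Unitary.star_mul_self_of_mem (hπ g)) x

theorem isUnitaryRep_of_norm_map (h : ∀ g x, ‖π g x‖ = ‖x‖) : IsUnitaryRep π := by
  intro g
  have h1 : star (π g) * π g = 1 := (ContinuousLinearMap.norm_map_iff_adjoint_comp_self (π g)).1 (h g)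
  have h2 : π g * π g⁻¹ = 1 := by rw [← map_mul, mul_inv_cancel, map_one]
  have h3 : star (π g) = π g⁻¹ := left_inv_eq_right_inv h1 h2
  exact Unitary.mem_iff.2 ⟨h1, by rw [h3, h2]⟩

theorem IsUnitaryRep.inner_map_map (hπ : IsUnitaryRep π) (g : Γ) (x y : E) :
    ⟪π g x, π g y⟫_ℂ = ⟪x, y⟫_ℂ :=
  LinearIsometry.inner_map_map (⟨(π g : E →ₗ[ℂ] E), hπ.norm_map g⟩ : E →ₗᵢ[ℂ] E) x y

theorem IsUnitaryRep.inner_map_left (hπ : IsUnitaryRep π) (g : Γ) (x y : E) :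
    ⟪π g x, y⟫_ℂ = ⟪x, π g⁻¹ y⟫_ℂ := by
  conv_lhs => rw [← map_apply_map_inv_apply π g y]
  exact hπ.inner_map_map g _ _

theorem IsUnitaryRep.map_mem_orthogonal_invariants (hπ : IsUnitaryRep π) (g : Γ) {x : E}
    (hx : x ∈ (invariants π)ᗮ) : π g x ∈ (invariants π)ᗮ := by
  intro w hw
  rw [← inner_conj_symm, hπ.inner_map_left, hw g⁻¹, inner_conj_symm]
  exact hx w hw

/-- A `(Q, κδ)`-invariant vector is at distance less than `δ` from an invariant vector. -/
theorem IsUnitaryRep.exists_invariant_norm_sub_lt (hπ : IsUnitaryRep π) {Q : Finset Γ} {κ : ℝ}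
    (hκ : 0 < κ)
    (hT : ∀ (E : Type u) [NormedAddCommGroup E] [InnerProductSpace ℂ E] [CompleteSpace E]
      (π : Γ →* (E →L[ℂ] E)), IsUnitaryRep π →
      (∃ v : E, v ≠ 0 ∧ ∀ s ∈ Q, ‖π s v - v‖ < κ * ‖v‖) →
      ∃ w : E, w ≠ 0 ∧ ∀ g : Γ, π g w = w)
    {v : E} {δ : ℝ} (hδ : 0 < δ) (hv : ∀ s ∈ Q, ‖π s v - v‖ < κ * δ) :
    ∃ w : E, (∀ g, π g w = w) ∧ ‖v - w‖ < δ := by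
  have : CompleteSpace (invariants π) := (isClosed_invariants π).completeSpace_coe
  let M := invariants π
  let w : E := M.starProjection v
  have hw : w ∈ M := M.starProjection_apply_mem v
  have hv' : v - w ∈ Mᗮ := M.sub_starProjection_mem_orthogonal v
  refine ⟨w, hw, ?_⟩
  by_contra! hlt
  -- If `v - w` had norm at least δ, it would be (Q, κ)-invariant in the orthogonal complement of
  -- the invariants, which would then contain a nonzero invariant vector.
  let τ : Γ →* (Mᗮ →L[ℂ] Mᗮ) :=
    { toFun := fun g => ((π g).comp Mᗮ.subtypeL).codRestrict Mᗮ fun x =>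
        hπ.map_mem_orthogonal_invariants g x.2
      map_one' := by ext x; simp
      map_mul' := fun g h => ContinuousLinearMap.ext fun x => Subtype.ext (map_mul_apply π g h x) }
  have hτ : ∀ g (x : Mᗮ), (τ g x : E) = π g x := fun g x => rfl
  obtain ⟨z, hz0, hz⟩ := hT Mᗮ τ
    (isUnitaryRep_of_norm_map fun g x => by
      rw [Submodule.coe_norm, Submodule.coe_norm, hτ, hπ.norm_map])
    ⟨⟨v - w, hv'⟩, fun h => by
      have h0 : v - w = 0 := congrArg Subtype.val h
      rw [h0, norm_zero] at hlt
      exact hlt.not_gt hδ, fun s hs => by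
      rw [Submodule.coe_norm, Submodule.coe_norm, Submodule.coe_sub, hτ]
      have h1 : π s (v - w) - (v - w) = π s v - v := by
        rw [map_sub, hw s]
        abel
      rw [h1]
      exact (hv s hs).trans_le (mul_le_mul_of_nonneg_left hlt hκ.le)⟩
  refine hz0 (Subtype.ext ?_)
  have hzM : (z : E) ∈ M := fun g => by rw [← hτ, hz g]
  exact inner_self_eq_zero.1 (z.2 z hzM)

theorem norm_linearCombination_eq {X F : Type*} [NormedAddCommGroup F] [InnerProductSpace ℂ F]
    {φ ψ : X → F} (h : ∀ x y, ⟪φ x, φ y⟫_ℂ = ⟪ψ x, ψ y⟫_ℂ) (f : X →₀ ℂ) :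
    ‖Finsupp.linearCombination ℂ φ f‖ = ‖Finsupp.linearCombination ℂ ψ f‖ := by
  have h2 : ⟪Finsupp.linearCombination ℂ φ f, Finsupp.linearCombination ℂ φ f⟫_ℂ =
      ⟪Finsupp.linearCombination ℂ ψ f, Finsupp.linearCombination ℂ ψ f⟫_ℂ := by
    simp only [Finsupp.linearCombination_apply, Finsupp.sum, sum_inner, inner_sum,
      inner_smul_left, inner_smul_right, h]
  rw [@norm_eq_sqrt_re_inner ℂ, h2, ← @norm_eq_sqrt_re_inner ℂ]

/-- A group of permutations of a total set preserving inner products extends to a unitary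
representation. -/
theorem exists_unitaryRep_extending {X : Type*} {φ : X → E}
    (hφ : DenseRange (Finsupp.linearCombination ℂ φ)) (σ : Γ →* Equiv.Perm X)
    (h : ∀ g x y, ⟪φ (σ g x), φ (σ g y)⟫_ℂ = ⟪φ x, φ y⟫_ℂ) :
    ∃ U : Γ →* (E →L[ℂ] E), IsUnitaryRep U ∧ ∀ g x, U g (φ x) = φ (σ g x) := by
  have hn : ∀ g (f : X →₀ ℂ), ‖Finsupp.linearCombination ℂ φ (Finsupp.domLCongr (R := ℂ) (σ g) f)‖ =
      ‖Finsupp.linearCombination ℂ φ f‖ := fun g f => by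
    have h1 : Finsupp.linearCombination ℂ φ (Finsupp.domLCongr (R := ℂ) (σ g) f) =
        Finsupp.linearCombination ℂ (φ ∘ σ g) f := by
      simp [Finsupp.domLCongr_apply, Finsupp.domCongr_apply, Finsupp.equivMapDomain_eq_mapDomain,
        Finsupp.linearCombination_mapDomain]
    rw [h1]
    exact norm_linearCombination_eq (h g) f
  let V : Γ → (E ≃ₗᵢ[ℂ] E) := fun g =>
    (Finsupp.domLCongr (R := ℂ) (M := ℂ) (σ g)).extendOfIsometry _ _ hφ hφ (hn g)
  have hV : ∀ g f, V g (Finsupp.linearCombination ℂ φ f) =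
      Finsupp.linearCombination ℂ φ (Finsupp.domLCongr (R := ℂ) (σ g) f) := fun g f =>
    LinearEquiv.extendOfIsometry_eq _ _ _ hφ hφ (hn g) f
  let U : Γ →* (E →L[ℂ] E) :=
    { toFun := fun g => (V g).toContinuousLinearEquiv
      map_one' := by
        ext x
        refine congrFun (hφ.equalizer (V 1).continuous continuous_id (funext fun f => ?_)) x
        simp [hV]
      map_mul' := fun g k => by
        ext x
        refine congrFun (hφ.equalizer (V (g * k)).continuous
          ((V g).continuous.comp (V k).continuous) (funext fun f => ?_)) x
        simp only [Function.comp_apply, hV]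
        congr 1
        ext x
        simp only [Finsupp.domLCongr_apply, Finsupp.domCongr_apply, Finsupp.equivMapDomain_apply,
          map_mul]
        rfl }
  refine ⟨U, isUnitaryRep_of_norm_map fun g x => (V g).norm_map x, fun g x => ?_⟩
  have h1 : V g (φ x) = φ (σ g x) := by simpa using hV g (Finsupp.single x 1)
  exact h1

/-- A bounded cocycle of a unitary representation is a coboundary. -/
theorem IsUnitaryRep.exists_fixed_of_bounded (hπ : IsUnitaryRep π) {b : Γ → E}
    (hb : ∀ g h, b (g * h) = π g (b h) + b g) {R : ℝ} (hR : ∀ g, ‖b g‖ ≤ R) :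
    ∃ x, ∀ g, π g x + b g = x := by
  -- `r x` is the squared radius of the smallest ball about `x` containing the orbit `b` of 0. Its
  -- minimiser, the Chebyshev centre of the orbit, is unique, hence fixed.
  let r : E → ℝ := fun x => ⨆ g, ‖b g - x‖ ^ 2
  have hbdd : ∀ x, BddAbove (Set.range fun g => ‖b g - x‖ ^ 2) := fun x => by
    refine ⟨(R + ‖x‖) ^ 2, ?_⟩
    rintro _ ⟨g, rfl⟩
    exact pow_le_pow_left₀ (norm_nonneg _) ((norm_sub_le _ _).trans (by gcongr; exact hR g)) 2
  have hle : ∀ x g, ‖b g - x‖ ^ 2 ≤ r x := fun x g => le_ciSup (hbdd x) g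
  have hr0 : ∀ x, 0 ≤ r x := fun x => (sq_nonneg _).trans (hle x 1)
  let I : ℝ := ⨅ x, r x
  have hI : ∀ x, I ≤ r x := fun x => ciInf_le ⟨0, by rintro _ ⟨x, rfl⟩; exact hr0 x⟩ x
  -- The parallelogram law at the midpoint gives both convergence of minimising sequences and
  -- uniqueness of the minimiser.
  have hmid : ∀ x y, ‖x - y‖ ^ 2 ≤ 2 * (r x + r y) - 4 * I := fun x y => by
    have h1 : r ((2 : ℂ)⁻¹ • (x + y)) ≤ (r x + r y) / 2 - ‖x - y‖ ^ 2 / 4 := by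
      refine ciSup_le fun g => ?_
      have h2 := parallelogram_law_with_norm ℂ (b g - x) (b g - y)
      have h3 : b g - (2 : ℂ)⁻¹ • (x + y) = (2 : ℂ)⁻¹ • ((b g - x) + (b g - y)) := by
        module
      have h4 : (b g - x) - (b g - y) = y - x := by abel
      rw [h4, norm_sub_rev y x] at h2
      rw [h3, norm_smul]
      have h5 := hle x g
      have h6 := hle y g
      norm_num
      nlinarith
    have := hI ((2 : ℂ)⁻¹ • (x + y))
    linarith
  have hseq : ∀ n : ℕ, ∃ x, r x < I + 1 / ((n : ℝ) + 1) := fun n =>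
    exists_lt_of_ciInf_lt (lt_add_of_pos_right I Nat.one_div_pos_of_nat)
  choose x hx using hseq
  have hlim0 : Filter.Tendsto (fun n : ℕ => 1 / ((n : ℝ) + 1)) Filter.atTop (nhds 0) :=
    tendsto_one_div_add_atTop_nhds_zero_nat
  have hcauchy : CauchySeq x := by
    refine cauchySeq_of_le_tendsto_0 (fun n : ℕ => √(4 * (1 / ((n : ℝ) + 1)))) ?_ ?_
    · intro n m N hn hm
      rw [dist_eq_norm]
      refine Real.le_sqrt_of_sq_le ((hmid _ _).trans ?_)
      have h1 : 1 / ((n : ℝ) + 1) ≤ 1 / ((N : ℝ) + 1) := Nat.one_div_le_one_div hn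
      have h2 : 1 / ((m : ℝ) + 1) ≤ 1 / ((N : ℝ) + 1) := Nat.one_div_le_one_div hm
      linarith [hx n, hx m]
    · have := (hlim0.const_mul 4).sqrt
      simpa using this
  obtain ⟨c, hc⟩ := cauchySeq_tendsto_of_complete hcauchy
  have hcI : ∀ g, ‖b g - c‖ ^ 2 ≤ I := fun g => by
    refine le_of_tendsto_of_tendsto' (((tendsto_const_nhds.sub hc).norm).pow 2)
      (by simpa using hlim0.const_add I) fun n => (hle (x n) g).trans (hx n).le
  refine ⟨c, fun h => ?_⟩
  have h1 : r c ≤ I := ciSup_le hcI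
  have h2 : r (π h c + b h) ≤ I := ciSup_le fun g => by
    have h3 : b g - (π h c + b h) = π h (b (h⁻¹ * g) - c) := by
      have := hb h (h⁻¹ * g)
      rw [mul_inv_cancel_left] at this
      rw [this, map_sub]
      abel
    rw [h3, hπ.norm_map]
    exact hcI _
  have h4 := hmid (π h c + b h) c
  have h5 : ‖π h c + b h - c‖ ^ 2 ≤ 0 := h4.trans (by linarith)
  have h6 : ‖π h c + b h - c‖ = 0 := by
    have := sq_nonneg ‖π h c + b h - c‖
    exact pow_eq_zero_iff two_ne_zero |>.1 (le_antisymm h5 this)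
  exact sub_eq_zero.1 (norm_eq_zero.1 h6)

end Unitary

/-! ### Property (T) kills the first cohomology of unitary representations -/

section Delorme

open scoped InnerProductSpace

variable {Γ : Type v} [Group Γ] {E : Type u} [NormedAddCommGroup E]

/-- The feature vectors are unit vectors, so small distances in `H` bound distances in `E`. -/
theorem norm_sub_sq_of_inner_eq_gaussian {H : Type*} [NormedAddCommGroup H]
    [InnerProductSpace ℂ H] {φ : E → H} {t : ℝ}
    (hφ : ∀ x y, ⟪φ x, φ y⟫_ℂ = (Real.exp (-t * ‖x - y‖ ^ 2) : ℂ)) (x y : E) :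
    ‖φ x - φ y‖ ^ 2 = 2 - 2 * Real.exp (-t * ‖x - y‖ ^ 2) := by
  have h1 : ∀ x, ‖φ x‖ ^ 2 = 1 := fun x => by
    rw [← @inner_self_eq_norm_sq ℂ, hφ]
    simp
  rw [@norm_sub_sq ℂ, h1, h1, hφ]
  simp only [RCLike.re_to_complex, Complex.ofReal_re]
  ring

variable [InnerProductSpace ℂ E] [CompleteSpace E] {π : Γ →* (E →L[ℂ] E)}

/-- The Delorme theorem: a cocycle of a unitary representation of a group with property (T) is a
coboundary. -/
theorem HasPropertyT.exists_fixed_of_cocycle (hT : HasPropertyT.{u, v} Γ) (hπ : IsUnitaryRep π)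
    {b : Γ → E} (hb : ∀ g h, b (g * h) = π g (b h) + b g) :
    ∃ x, ∀ g, π g x + b g = x := by
  obtain ⟨Q, κ, hκ, hT⟩ := hT
  have hb1 : b 1 = 0 := by simpa using hb 1 1
  let σ : Γ →* Equiv.Perm E := MonoidHom.toHomPerm
    { toFun := fun g x => π g x + b g
      map_one' := by
        funext x
        simp [hb1]
        rfl
      map_mul' := fun g h => by
        funext x
        change π (g * h) x + b (g * h) = π g (π h x + b h) + b g
        rw [hb, map_mul_apply, map_add, add_assoc] }
  have hσ : ∀ g x, σ g x = π g x + b g := fun g x => rfl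
  -- As t → 0 the Gaussian feature map flattens, so `φ 0` becomes almost invariant under the finite
  -- set `Q`.
  have ht : ∃ t : ℝ, 0 < t ∧ ∀ s ∈ Q, 2 - 2 * Real.exp (-t * ‖b s‖ ^ 2) < (κ * (1 / 2)) ^ 2 := by
    have h1 : ∀ᶠ t : ℝ in nhds 0,
        ∀ s ∈ Q, 2 - 2 * Real.exp (-t * ‖b s‖ ^ 2) < (κ * (1 / 2)) ^ 2 := by
      refine (Filter.eventually_all_finset Q).2 fun s _ => ?_
      have h2 : Continuous fun t : ℝ => 2 - 2 * Real.exp (-t * ‖b s‖ ^ 2) := by fun_prop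
      refine h2.continuousAt.eventually_lt_const ?_
      simp only [neg_zero, zero_mul, Real.exp_zero]
      have : 0 < (κ * (1 / 2)) ^ 2 := by positivity
      linarith
    obtain ⟨t, ht, ht0⟩ := ((h1.filter_mono nhdsWithin_le_nhds).and
      (self_mem_nhdsWithin : Set.Ioi (0 : ℝ) ∈ nhdsWithin 0 (Set.Ioi 0))).exists
    exact ⟨t, ht0, ht⟩
  obtain ⟨t, ht0, ht⟩ := ht
  obtain ⟨H, _, _, _, φ, hφ, hdense⟩ :=
    exists_feature_map (posSemidef_gaussian (E := E) ht0.le)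
  simp only [Matrix.of_apply] at hφ
  have hdist := norm_sub_sq_of_inner_eq_gaussian hφ
  obtain ⟨U, hU, hUφ⟩ := exists_unitaryRep_extending hdense σ fun g x y => by
    rw [hφ, hφ, hσ, hσ, add_sub_add_right_eq_sub, ← map_sub, hπ.norm_map]
  have hU0 : ∀ g, U g (φ 0) = φ (b g) := fun g => by rw [hUφ, hσ, map_zero, zero_add]
  -- With δ = 1/2 the orbit of `φ 0` moves by at most 1, so the Gaussian at `b g` stays at least
  -- 1/2. This bounds `b`.
  obtain ⟨w, hw, hwlt⟩ := hU.exists_invariant_norm_sub_lt hκ hT (v := φ 0) (δ := 1 / 2)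
    (by norm_num) fun s hs => by
      rw [hU0]
      refine lt_of_pow_lt_pow_left₀ 2 (by positivity) ?_
      rw [hdist, sub_zero]
      exact ht s hs
  refine hπ.exists_fixed_of_bounded hb (R := √(Real.log 2 / t)) fun g => ?_
  have h1 : ‖φ (b g) - φ 0‖ ≤ 1 := by
    have h2 : φ (b g) - φ 0 = U g (φ 0 - w) - (φ 0 - w) := by
      rw [map_sub, hw g, hU0]
      abel
    rw [h2]
    refine (norm_sub_le _ _).trans ?_
    rw [hU.norm_map]
    linarith
  have h3 := hdist (b g) 0
  rw [sub_zero] at h3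
  have h4 : ‖φ (b g) - φ 0‖ ^ 2 ≤ 1 := pow_le_one₀ (norm_nonneg _) h1
  have h5 : 1 / 2 ≤ Real.exp (-t * ‖b g‖ ^ 2) := by linarith
  have h6 : -Real.log 2 ≤ -t * ‖b g‖ ^ 2 := by
    rw [← Real.log_inv, ← one_div]
    exact (Real.log_le_iff_le_exp (by norm_num)).2 h5
  refine Real.le_sqrt_of_sq_le ((le_div_iff₀ ht0).2 ?_)
  linarith

end Delorme

/-! ### Finite presentations by products within a finite set -/

section Presentation

variable {Γ : Type v} [Group Γ]

/-- A finite set `T` presents `Γ` if it generates `Γ` and every map on `T` to a group which respects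
the products within `T` extends to a homomorphism. -/
def Presents (T : Finset Γ) : Prop :=
  Subgroup.closure (T : Set Γ) = ⊤ ∧ ∀ (G : Type w) [Group G] (f : Γ → G),
    (∀ g ∈ T, ∀ h ∈ T, g * h ∈ T → f (g * h) = f g * f h) → ∃ φ : Γ →* G, ∀ g ∈ T, φ g = f g

/-- Take the images of all words no longer than the longest relator. Peeling off letters shows that
a map respecting products there agrees with the induced map of the free group on such words, so
relators are killed. -/
theorem exists_presents (Γ : Type v) [Group Γ] [Group.IsFinitelyPresented Γ] :
    ∃ T : Finset Γ, Presents.{v, w} T := by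
  classical
  obtain ⟨n, p, hp, R, hR, hRp⟩ := Group.IsFinitelyPresented.out (G := Γ)
  -- `1 ≤ N` puts the generators and their inverses in `T`.
  obtain ⟨N, hN1, hN⟩ : ∃ N : ℕ, 1 ≤ N ∧ ∀ r ∈ R, r.toWord.length ≤ N := by
    obtain ⟨N, hN⟩ := (hR.image fun r => r.toWord.length).bddAbove
    exact ⟨N + 1, by omega, fun r hr => (hN ⟨r, hr, rfl⟩).trans (by omega)⟩
  have hfin : {L : List (Fin n × Bool) | L.length ≤ N}.Finite := List.finite_length_le _ N
  let T : Finset Γ := (hfin.image fun L => p (FreeGroup.mk L)).toFinset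
  have hT : ∀ L : List (Fin n × Bool), L.length ≤ N → p (FreeGroup.mk L) ∈ T := fun L hL =>
    (Set.Finite.mem_toFinset _).2 ⟨L, hL, rfl⟩
  refine ⟨T, ?_, fun G _ f hf => ?_⟩
  · rw [eq_top_iff, ← MonoidHom.range_eq_top.2 hp, MonoidHom.range_eq_map,
      ← FreeGroup.closure_range_of, MonoidHom.map_closure, Subgroup.closure_le]
    rintro _ ⟨_, ⟨i, rfl⟩, rfl⟩
    exact Subgroup.subset_closure (hT [(i, true)] hN1)
  · have hone : (1 : Γ) ∈ T := by simpa [← FreeGroup.one_eq_mk] using hT [] (Nat.zero_le _)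
    have hf1 : f 1 = 1 := by simpa using hf 1 hone 1 hone (by simpa using hone)
    let ψ : FreeGroup (Fin n) →* G := FreeGroup.lift fun i => f (p (FreeGroup.of i))
    have hletter : ∀ x : Fin n × Bool, ψ (FreeGroup.mk [x]) = f (p (FreeGroup.mk [x])) := by
      rintro ⟨i, b⟩
      have ht : ψ (FreeGroup.of i) = f (p (FreeGroup.of i)) := FreeGroup.lift_apply_of
      cases b with
      | true => exact ht
      | false =>
        have h1 : FreeGroup.mk [(i, false)] = (FreeGroup.of i)⁻¹ := rfl
        have h2 := hf _ (hT [(i, true)] hN1) _ (hT [(i, false)] hN1) (by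
          rw [h1, map_inv]
          change p (FreeGroup.of i) * _ ∈ T
          rwa [mul_inv_cancel])
        rw [h1, map_inv] at h2 ⊢
        change f (p (FreeGroup.of i) * _) = f (p (FreeGroup.of i)) * _ at h2
        rw [mul_inv_cancel, hf1] at h2
        rw [map_inv, ht]
        exact inv_eq_of_mul_eq_one_right h2.symm
    have hψ : ∀ L : List (Fin n × Bool), L.length ≤ N →
        ψ (FreeGroup.mk L) = f (p (FreeGroup.mk L)) := by
      intro L
      induction L with
      | nil => exact fun _ => by rw [← FreeGroup.one_eq_mk, map_one, map_one, hf1]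
      | cons x L ih =>
        intro hL
        have hL' : L.length ≤ N := (Nat.le_succ _).trans hL
        have h1 : FreeGroup.mk (x :: L) = FreeGroup.mk [x] * FreeGroup.mk L := by
          rw [FreeGroup.mul_mk]
          rfl
        have h2 := hT (x :: L) hL
        rw [h1, map_mul] at h2
        rw [h1, map_mul, map_mul, hf _ (hT [x] hN1) _ (hT L hL') h2, ih hL', hletter]
    have hker : p.ker ≤ ψ.ker := by
      rw [← hRp]
      refine Subgroup.normalClosure_le_normal fun r hr => ?_
      have hr1 : p r = 1 := by
        rw [← MonoidHom.mem_ker, ← hRp]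
        exact Subgroup.subset_normalClosure hr
      have h1 := hψ r.toWord (hN r hr)
      rw [FreeGroup.mk_toWord, hr1, hf1] at h1
      exact h1
    refine ⟨p.liftOfSurjective hp ⟨ψ, hker⟩, fun g hg => ?_⟩
    obtain ⟨L, hL, rfl⟩ := (Set.Finite.mem_toFinset _).1 hg
    rw [← hψ L hL]
    exact MonoidHom.liftOfRightInverse_comp_apply p _ _ ⟨ψ, hker⟩ _

/-- The cocycle identity on `T` says that the affine permutations v ↦ ρ g v + b g multiply correctly
within `T`, so they extend to an action of Γ; the orbit of 0 is the cocycle. No topology on `V` is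
used, so that `V` may be a quotient by a non-closed subspace. -/
theorem Presents.exists_cocycle {T : Finset Γ} (hT : Presents.{v, w} T) {V : Type w}
    [AddCommGroup V] [Module ℂ V] (ρ : Γ →* Module.End ℂ V) (b : Γ → V)
    (hb : ∀ g ∈ T, ∀ h ∈ T, g * h ∈ T → b (g * h) = ρ g (b h) + b g) :
    ∃ β : Γ → V, (∀ g h, β (g * h) = ρ g (β h) + β g) ∧ ∀ g ∈ T, β g = b g := by
  have hmul : ∀ g h v, ρ (g * h) v = ρ g (ρ h v) := fun g h v => by
    rw [map_mul]
    rfl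
  have hinv : ∀ g v, ρ g⁻¹ (ρ g v) = v := fun g v => by
    rw [← hmul, inv_mul_cancel, map_one]
    rfl
  have hinv' : ∀ g v, ρ g (ρ g⁻¹ v) = v := fun g v => by
    rw [← hmul, mul_inv_cancel, map_one]
    rfl
  let f : Γ → Equiv.Perm V := fun g =>
    { toFun := fun v => ρ g v + b g
      invFun := fun v => ρ g⁻¹ (v - b g)
      left_inv := fun v => by simp [hinv]
      right_inv := fun v => by simp [hinv'] }
  have hf : ∀ g v, f g v = ρ g v + b g := fun g v => rfl
  obtain ⟨φ, hφ⟩ := hT.2 (Equiv.Perm V) f fun g hg h hh hgh => by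
    ext v
    rw [Equiv.Perm.mul_apply, hf, hf, hf, hb g hg h hh hgh, hmul, map_add, add_assoc]
  have key : ∀ g v, φ g v = ρ g v + φ g 0 := fun g => by
    have hg : g ∈ Subgroup.closure (T : Set Γ) := hT.1 ▸ Subgroup.mem_top g
    induction hg using Subgroup.closure_induction with
    | mem g hg =>
      intro v
      rw [hφ g hg, hf, hf, map_zero, zero_add]
    | one => simp
    | mul g h _ _ ihg ihh =>
      intro v
      rw [map_mul, Equiv.Perm.mul_apply, Equiv.Perm.mul_apply, ihg, ihh, ihg (φ h 0), hmul, map_add,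
        add_assoc]
    | inv g _ ih =>
      intro v
      have h1 : ∀ v, φ g (φ g⁻¹ v) = v := fun v => by
        rw [← Equiv.Perm.mul_apply, ← map_mul, mul_inv_cancel, map_one]
        rfl
      refine (φ g).injective ?_
      have h2 := h1 0
      rw [ih] at h2
      rw [h1, ih, map_add, hinv', add_assoc, h2, add_zero]
  refine ⟨fun g => φ g 0, fun g h => ?_, fun g hg => ?_⟩
  · simp only [map_mul, Equiv.Perm.mul_apply]
    exact key _ _
  · simp only [hφ g hg, hf, map_zero, zero_add]

end Presentation

/-! ### Reduced second cohomology and closed range -/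

section ClosedRange

open Filter Topology

variable {Γ : Type v} [Group Γ] {E : Type u} [NormedAddCommGroup E] [NormedSpace ℂ E]

variable (E) in
/-- The convergent sequences. -/
def convergentSeq : Submodule ℂ (ℕ → E) where
  carrier := {x | ∃ y, Tendsto x atTop (𝓝 y)}
  add_mem' := fun ⟨y, hy⟩ ⟨z, hz⟩ => ⟨y + z, hy.add hz⟩
  zero_mem' := ⟨0, tendsto_const_nhds⟩
  smul_mem' := fun a _ ⟨y, hy⟩ => ⟨a • y, hy.const_smul a⟩

/-- The representation induced on sequences modulo convergent sequences. -/
def seqQuotientRep (π : Γ →* (E →L[ℂ] E)) : Γ →* Module.End ℂ ((ℕ → E) ⧸ convergentSeq E) where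
  toFun g := (convergentSeq E).mapQ (convergentSeq E) ((π g : E →ₗ[ℂ] E).compLeft ℕ)
    fun _ ⟨y, hy⟩ => ⟨π g y, ((π g).continuous.tendsto y).comp hy⟩
  map_one' := by
    ext x
    simp
    rfl
  map_mul' g h := by
    refine LinearMap.ext fun x => ?_
    obtain ⟨x, rfl⟩ := Submodule.Quotient.mk_surjective _ x
    simp only [Submodule.mapQ_apply, Module.End.mul_apply, map_mul]
    rfl

/-- This turns convergence of coboundaries into an exact, purely algebraic cocycle identity. -/
theorem mk_eq_seqQuotientRep_add_iff (π : Γ →* (E →L[ℂ] E)) (g h : Γ) (x : Γ → ℕ → E) :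
    (convergentSeq E).mkQ (x (g * h)) =
        seqQuotientRep π g ((convergentSeq E).mkQ (x h)) + (convergentSeq E).mkQ (x g) ↔
      ∃ y, Tendsto (fun n => d1 π (fun k => x k n) (g, h)) atTop (𝓝 y) := by
  have h1 : seqQuotientRep π g ((convergentSeq E).mkQ (x h)) + (convergentSeq E).mkQ (x g) =
      (convergentSeq E).mkQ ((fun n => π g (x h n)) + x g) := rfl
  have h2 : (fun n => π g (x h n)) + x g - x (g * h) = fun n => d1 π (fun k => x k n) (g, h) := by
    funext n
    simp only [d1, LinearMap.coe_mk, AddHom.coe_mk, Pi.sub_apply, Pi.add_apply]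
    abel
  rw [h1, eq_comm, Submodule.mkQ_apply, Submodule.mkQ_apply, Submodule.Quotient.eq, h2]
  rfl

theorem continuous_d2_apply (π : Γ →* (E →L[ℂ] E)) (p : Γ × Γ × Γ) :
    Continuous fun c : Γ × Γ → E => d2 π c p := by
  change Continuous fun c : Γ × Γ → E =>
    π p.1 (c (p.2.1, p.2.2)) - c (p.1 * p.2.1, p.2.2) + c (p.1, p.2.1 * p.2.2) - c (p.1, p.2.1)
  fun_prop

theorem H2IsReduced.exists_d1_eq_of_tendsto {π : Γ →* (E →L[ℂ] E)} (hred : H2IsReduced π)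
    {b : ℕ → Γ → E} {y : Γ × Γ → E} (hy : ∀ p, Tendsto (fun n => d1 π (b n) p) atTop (𝓝 (y p))) :
    ∃ c, d1 π c = y := by
  have hy' : Tendsto (fun n => d1 π (b n)) atTop (𝓝 y) := tendsto_pi_nhds.2 hy
  have hmem : ∀ n, d1 π (b n) ∈ twoCocycles π := fun n =>
    twoCoboundaries_le_twoCocycles π ⟨b n, rfl⟩
  have hyZ : y ∈ twoCocycles π := by
    refine LinearMap.mem_ker.2 (funext fun p => ?_)
    refine tendsto_nhds_unique (((continuous_d2_apply π p).tendsto y).comp hy') ?_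
    refine tendsto_const_nhds.congr fun n => ?_
    exact (congrFun (LinearMap.mem_ker.1 (hmem n)) p).symm
  have hcl : (⟨y, hyZ⟩ : twoCocycles π) ∈
      closure {z : twoCocycles π | (z : Γ × Γ → E) ∈ twoCoboundaries π} :=
    mem_closure_of_tendsto (f := fun n => (⟨d1 π (b n), hmem n⟩ : twoCocycles π)) (b := atTop)
      (tendsto_subtype_rng.2 hy') (Eventually.of_forall fun n => ⟨b n, rfl⟩)
  rw [hred] at hcl
  exact hcl

/-- If `H²(Γ, π)` is reduced, then the coboundary map restricted to a presenting set has closed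
range. -/
theorem Presents.exists_d1_eq_of_tendsto {T : Finset Γ} (hT : Presents.{v, u} T)
    {π : Γ →* (E →L[ℂ] E)} (hred : H2IsReduced π) {b : ℕ → Γ → E} {z : Γ × Γ → E}
    (hz : ∀ g ∈ T, ∀ h ∈ T, g * h ∈ T → Tendsto (fun n => d1 π (b n) (g, h)) atTop (𝓝 (z (g, h)))) :
    ∃ c : Γ → E, ∀ g ∈ T, ∀ h ∈ T, g * h ∈ T → d1 π c (g, h) = z (g, h) := by
  classical
  -- Modulo convergent sequences, `b` is a cocycle on `T`, hence extends to Γ. A lift of the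
  -- extension has coboundaries converging on all of Γ × Γ, where reducedness applies.
  obtain ⟨β, hβ, hβT⟩ := hT.exists_cocycle (seqQuotientRep π)
    (fun g => (convergentSeq E).mkQ fun n => b n g) fun g hg h hh hgh =>
      (mk_eq_seqQuotientRep_add_iff π g h fun g n => b n g).2 ⟨_, hz g hg h hh hgh⟩
  -- On `T` the lift must be `b` itself, so that the limits there are the prescribed `z`.
  have hlift : ∀ g, ∃ x : ℕ → E, (convergentSeq E).mkQ x = β g ∧
      (g ∈ T → x = fun n => b n g) := by
    intro g
    by_cases hg : g ∈ T
    · exact ⟨_, (hβT g hg).symm, fun _ => rfl⟩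
    · obtain ⟨x, hx⟩ := Submodule.mkQ_surjective _ (β g)
      exact ⟨x, hx, fun h => absurd h hg⟩
  choose x hx hxT using hlift
  have hconv : ∀ p : Γ × Γ, ∃ y, Tendsto (fun n => d1 π (fun g => x g n) p) atTop (𝓝 y) := by
    rintro ⟨g, h⟩
    rw [← mk_eq_seqQuotientRep_add_iff, hx, hx, hx]
    exact hβ g h
  choose y hy using hconv
  obtain ⟨c, hc⟩ := hred.exists_d1_eq_of_tendsto hy
  refine ⟨c, fun g hg h hh hgh => ?_⟩
  rw [hc]
  refine tendsto_nhds_unique (hy (g, h)) ((hz g hg h hh hgh).congr fun n => ?_)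
  simp only [d1, LinearMap.coe_mk, AddHom.coe_mk, hxT g hg, hxT h hh, hxT _ hgh]

end ClosedRange

/-! ### Stability of exactness for Hilbert space complexes -/

section Complex

open scoped InnerProductSpace

variable {A B C : Type*} [NormedAddCommGroup A] [InnerProductSpace ℂ A] [CompleteSpace A]
  [NormedAddCommGroup B] [InnerProductSpace ℂ B] [CompleteSpace B]
  [NormedAddCommGroup C] [InnerProductSpace ℂ C] [CompleteSpace C]

/-- By the open mapping theorem `d₁ x` has a preimage `y` of norm controlled by ‖d₁ x‖. The rest `x
- y` lies in ker d₁ = range d₀, where the adjoint of `d₀` is bounded below. -/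
theorem exists_gap_of_exact {d₀ : A →L[ℂ] B} {d₁ : B →L[ℂ] C} (hcomp : ∀ v, d₁ (d₀ v) = 0)
    (hexact : ∀ x, d₁ x = 0 → ∃ v, d₀ v = x) (hclosed : IsClosed (Set.range d₁)) :
    ∃ c : ℝ, 0 < c ∧ ∀ x, c * ‖x‖ ≤ ‖d₀.adjoint x‖ + ‖d₁ x‖ := by
  have h1 : ∃ C₁ > 0, ∀ x, ∃ y, d₁ y = d₁ x ∧ ‖y‖ ≤ C₁ * ‖d₁ x‖ := by
    have : CompleteSpace d₁.range := hclosed.completeSpace_coe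
    obtain ⟨C₁, hC₁, h⟩ := (d₁.rangeRestrict).exists_preimage_norm_le fun z => by
      obtain ⟨_, x, rfl⟩ := z
      exact ⟨x, rfl⟩
    refine ⟨C₁, hC₁, fun x => ?_⟩
    obtain ⟨y, hy, hn⟩ := h ⟨d₁ x, x, rfl⟩
    exact ⟨y, congrArg Subtype.val hy, hn⟩
  have h0 : ∃ C₀ > 0, ∀ x, d₁ x = 0 → ∃ v, d₀ v = x ∧ ‖v‖ ≤ C₀ * ‖x‖ := by
    have : CompleteSpace d₁.ker := d₁.isClosed_ker.completeSpace_coe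
    obtain ⟨C₀, hC₀, h⟩ := (d₀.codRestrict d₁.ker hcomp).exists_preimage_norm_le fun z => by
      obtain ⟨v, hv⟩ := hexact z z.2
      exact ⟨v, Subtype.ext hv⟩
    refine ⟨C₀, hC₀, fun x hx => ?_⟩
    obtain ⟨v, hv, hn⟩ := h ⟨x, hx⟩
    exact ⟨v, congrArg Subtype.val hv, hn⟩
  obtain ⟨C₁, hC₁, h1⟩ := h1
  obtain ⟨C₀, hC₀, h0⟩ := h0
  let a := ‖d₀.adjoint‖
  have ha : 0 ≤ a := norm_nonneg _
  let K := C₀ + (1 + C₀ * a) * C₁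
  have hK : 0 < K := by positivity
  refine ⟨K⁻¹, by positivity, fun x => ?_⟩
  obtain ⟨y, hy, hyn⟩ := h1 x
  obtain ⟨v, hv, hvn⟩ := h0 (x - y) (by rw [map_sub, hy, sub_self])
  have h2 : ‖x - y‖ ≤ C₀ * ‖d₀.adjoint (x - y)‖ := by
    have h3 : ‖x - y‖ ^ 2 ≤ ‖d₀.adjoint (x - y)‖ * ‖v‖ := by
      rw [← @inner_self_eq_norm_sq ℂ]
      conv_lhs => rw [← hv, ← ContinuousLinearMap.adjoint_inner_left, hv]
      exact (RCLike.re_le_norm _).trans (norm_inner_le_norm _ _)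
    rcases (norm_nonneg (x - y)).eq_or_lt with h4 | h4
    · rw [← h4]
      positivity
    · refine le_of_mul_le_mul_right ?_ h4
      calc ‖x - y‖ * ‖x - y‖ = ‖x - y‖ ^ 2 := (sq _).symm
        _ ≤ ‖d₀.adjoint (x - y)‖ * (C₀ * ‖x - y‖) := h3.trans (by gcongr)
        _ = C₀ * ‖d₀.adjoint (x - y)‖ * ‖x - y‖ := by ring
  have h5 : ‖d₀.adjoint (x - y)‖ ≤ ‖d₀.adjoint x‖ + a * ‖y‖ := by
    rw [map_sub]
    exact (norm_sub_le _ _).trans (by gcongr; exact d₀.adjoint.le_opNorm y)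
  have h6 : ‖x‖ ≤ ‖x - y‖ + ‖y‖ := by simpa using norm_add_le (x - y) y
  rw [inv_mul_le_iff₀ hK]
  calc ‖x‖ ≤ C₀ * (‖d₀.adjoint x‖ + a * (C₁ * ‖d₁ x‖)) + C₁ * ‖d₁ x‖ := by
        refine h6.trans (add_le_add (h2.trans ?_) hyn)
        gcongr
        exact h5.trans (by gcongr)
    _ = C₀ * ‖d₀.adjoint x‖ + (1 + C₀ * a) * C₁ * ‖d₁ x‖ := by ring
    _ ≤ K * ‖d₀.adjoint x‖ + K * ‖d₁ x‖ := by
        gcongr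
        · exact le_add_of_nonneg_right (by positivity)
        · exact le_add_of_nonneg_left hC₀.le
    _ = K * (‖d₀.adjoint x‖ + ‖d₁ x‖) := by ring

/-- Exactness in the middle with closed ranges is stable under small perturbations. -/
theorem exact_of_gap {d₀ d₀' : A →L[ℂ] B} {d₁ d₁' : B →L[ℂ] C} {c : ℝ} (hc : 0 < c)
    (hgap : ∀ x, c * ‖x‖ ≤ ‖d₀.adjoint x‖ + ‖d₁ x‖) (h₀ : ‖d₀ - d₀'‖ ≤ c / 4)
    (h₁ : ‖d₁ - d₁'‖ ≤ c / 4) (hcomp : ∀ v, d₁' (d₀' v) = 0) {x : B} (hx : d₁' x = 0) :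
    ∃ v, d₀' v = x := by
  have hgap' : ∀ x, c / 2 * ‖x‖ ≤ ‖d₀'.adjoint x‖ + ‖d₁' x‖ := fun x => by
    have e0 : ‖d₀.adjoint x‖ ≤ ‖d₀'.adjoint x‖ + c / 4 * ‖x‖ := by
      have h2 : ‖(d₀ - d₀').adjoint x‖ ≤ c / 4 * ‖x‖ :=
        ContinuousLinearMap.le_of_opNorm_le _ (by rwa [LinearIsometryEquiv.norm_map]) x
      rw [map_sub, sub_apply] at h2
      linarith [norm_sub_norm_le (d₀.adjoint x) (d₀'.adjoint x)]
    have e1 : ‖d₁ x‖ ≤ ‖d₁' x‖ + c / 4 * ‖x‖ := by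
      have h2 : ‖(d₁ - d₁') x‖ ≤ c / 4 * ‖x‖ := ContinuousLinearMap.le_of_opNorm_le _ h₁ x
      rw [sub_apply] at h2
      linarith [norm_sub_norm_le (d₁ x) (d₁' x)]
    linarith [hgap x]
  -- The perturbed Laplacian is coercive with constant c²/8, from (a + b)² ≤ 2(a² + b²) and the gap
  -- c/2. If `L y = x` with `x` in ker d₁', the d₁' term vanishes, leaving a preimage under d₀'.
  let L : B →L[ℂ] B := d₀' ∘L d₀'.adjoint + d₁'.adjoint ∘L d₁'
  have hL : ∀ x, ⟪L x, x⟫_ℂ = ((‖d₀'.adjoint x‖ ^ 2 + ‖d₁' x‖ ^ 2 : ℝ) : ℂ) := fun x => by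
    simp only [L, add_apply, ContinuousLinearMap.comp_apply, inner_add_left,
      ContinuousLinearMap.adjoint_inner_left]
    rw [← ContinuousLinearMap.adjoint_inner_right, inner_self_eq_norm_sq_to_K,
      inner_self_eq_norm_sq_to_K]
    norm_num
  have hunit : IsUnit L := by
    refine ContinuousLinearMap.isUnit_of_forall_le_norm_inner_map L
      (c := ⟨c ^ 2 / 8, by positivity⟩) (by change (0 : ℝ) < c ^ 2 / 8; positivity) fun x => ?_
    rw [hL, Complex.norm_real, Real.norm_of_nonneg (by positivity)]
    change ‖x‖ ^ 2 * (c ^ 2 / 8) ≤ _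
    have h2 := pow_le_pow_left₀ (by positivity) (hgap' x) 2
    nlinarith [sq_nonneg (‖d₀'.adjoint x‖ - ‖d₁' x‖)]
  obtain ⟨y, hy⟩ : ∃ y, L y = x := by
    obtain ⟨M, hM⟩ := hunit.exists_right_inv
    exact ⟨M x, by rw [← mul_apply_eq_comp, hM, one_apply_eq_self]⟩
  have h2 : d₁' (d₁'.adjoint (d₁' y)) = 0 := by
    have := congrArg d₁' hy
    simpa [L, hcomp, hx] using this
  have h3 : d₁'.adjoint (d₁' y) = 0 := by
    rw [← inner_self_eq_zero (𝕜 := ℂ), ContinuousLinearMap.adjoint_inner_left, h2, inner_zero_right]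
  refine ⟨d₀'.adjoint y, ?_⟩
  simpa [L, h3] using hy

end Complex

/-! ### The complex of cochains restricted to a presenting set -/

section Truncated

open scoped InnerProductSpace
open Filter Topology

theorem norm_piLp_le_sum {ι F : Type*} [Fintype ι] [NormedAddCommGroup F]
    (x : PiLp 2 fun _ : ι => F) : ‖x‖ ≤ ∑ i, ‖x i‖ := by
  rw [PiLp.norm_eq_of_L2]
  refine Real.sqrt_le_iff.2 ⟨Finset.sum_nonneg fun _ _ => norm_nonneg _, ?_⟩
  exact Finset.sum_sq_le_sq_sum_of_nonneg fun i _ => norm_nonneg _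

variable {Γ : Type v} [Group Γ]

/-- The pairs of elements of `T` whose product is in `T`. -/
abbrev Triangle (T : Finset Γ) : Type v := {p : T × T // (p.1 : Γ) * p.2 ∈ T}

noncomputable instance (T : Finset Γ) : Fintype (Triangle T) := Fintype.ofFinite _

variable {E : Type u} [NormedAddCommGroup E]

section Normed

variable [NormedSpace ℂ E] (T : Finset Γ) (π : Γ →* (E →L[ℂ] E))

/-- The restriction of the coboundary `E → C¹(Γ, π)` to `T`. -/
noncomputable def truncD0 : E →L[ℂ] PiLp 2 fun _ : T => E :=
  (PiLp.continuousLinearEquiv 2 ℂ fun _ : T => E).symm.toContinuousLinearMap ∘L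
    ContinuousLinearMap.pi fun t => π t - 1

/-- The restriction of the coboundary `C¹(Γ, π) → C²(Γ, π)` to `T`. -/
noncomputable def truncD1 : (PiLp 2 fun _ : T => E) →L[ℂ] PiLp 2 fun _ : Triangle T => E :=
  (PiLp.continuousLinearEquiv 2 ℂ fun _ : Triangle T => E).symm.toContinuousLinearMap ∘L
    ContinuousLinearMap.pi fun p => π p.1.1 ∘L PiLp.proj 2 (fun _ : T => E) p.1.2 -
      PiLp.proj 2 (fun _ : T => E) ⟨p.1.1 * p.1.2, p.2⟩ + PiLp.proj 2 (fun _ : T => E) p.1.1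

@[simp]
theorem truncD0_apply (x : E) (t : T) : truncD0 T π x t = π t x - x := rfl

@[simp]
theorem truncD1_apply (x : PiLp 2 fun _ : T => E) (p : Triangle T) :
    truncD1 T π x p = π p.1.1 (x p.1.2) - x ⟨p.1.1 * p.1.2, p.2⟩ + x p.1.1 := rfl

theorem truncD1_truncD0 (x : E) : truncD1 T π (truncD0 T π x) = 0 := by
  ext p
  simp only [truncD1_apply, truncD0_apply, map_sub, map_mul_apply, PiLp.zero_apply]
  abel

variable {T π}

theorem norm_truncD0_sub_le {ρ : Γ →* (E →L[ℂ] E)} {δ : ℝ} (hδ : 0 ≤ δ)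
    (h : ∀ t ∈ T, ‖π t - ρ t‖ ≤ δ) :
    ‖truncD0 T π - truncD0 T ρ‖ ≤ Fintype.card T * δ := by
  refine ContinuousLinearMap.opNorm_le_bound _ (by positivity) fun x => ?_
  refine (norm_piLp_le_sum _).trans ((Finset.sum_le_card_nsmul _ _ (δ * ‖x‖) fun t _ => ?_).trans ?_)
  · have h1 : (truncD0 T π - truncD0 T ρ) x t = (π t - ρ t) x := by
      simp
    rw [h1]
    exact ContinuousLinearMap.le_of_opNorm_le _ (h t t.2) x
  · rw [nsmul_eq_mul, mul_assoc, Finset.card_univ]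

theorem norm_truncD1_sub_le {ρ : Γ →* (E →L[ℂ] E)} {δ : ℝ} (hδ : 0 ≤ δ)
    (h : ∀ t ∈ T, ‖π t - ρ t‖ ≤ δ) :
    ‖truncD1 T π - truncD1 T ρ‖ ≤ Fintype.card (Triangle T) * δ := by
  refine ContinuousLinearMap.opNorm_le_bound _ (by positivity) fun x => ?_
  refine (norm_piLp_le_sum _).trans ((Finset.sum_le_card_nsmul _ _ (δ * ‖x‖) fun p _ => ?_).trans ?_)
  · have h1 : (truncD1 T π - truncD1 T ρ) x p = (π p.1.1 - ρ p.1.1) (x p.1.2) := by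
      simp
    rw [h1]
    exact (ContinuousLinearMap.le_of_opNorm_le _ (h _ p.1.1.2) _).trans
      (by gcongr; exact PiLp.norm_apply_le x _)
  · rw [nsmul_eq_mul, mul_assoc, Finset.card_univ]

end Normed

variable [InnerProductSpace ℂ E] [CompleteSpace E] {T : Finset Γ} {π : Γ →* (E →L[ℂ] E)}

/-- The explicit formula makes the adjoint commute with equivariant isometries, as needed to pass
the gap to subrepresentations. -/
theorem IsUnitaryRep.adjoint_truncD0_apply (hπ : IsUnitaryRep π) (x : PiLp 2 fun _ : T => E) :
    (truncD0 T π).adjoint x = ∑ t : T, (π (t : Γ)⁻¹ (x t) - x t) := by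
  refine ext_inner_right ℂ fun y => ?_
  rw [ContinuousLinearMap.adjoint_inner_left, PiLp.inner_apply, sum_inner]
  refine Finset.sum_congr rfl fun t _ => ?_
  rw [truncD0_apply, inner_sub_right, inner_sub_left, hπ.inner_map_left, inv_inv]

/-- The complex `E → E^T → E^P` of the restrictions of cochains to `T` is exact in the middle with
closed ranges, quantitatively: `c` is a lower bound for its first Laplacian. -/
def HasGap (T : Finset Γ) (π : Γ →* (E →L[ℂ] E)) (c : ℝ) : Prop :=
  ∀ x, c * ‖x‖ ≤ ‖(truncD0 T π).adjoint x‖ + ‖truncD1 T π x‖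

theorem exists_hasGap (hT : HasPropertyT.{u, v} Γ) (hP : Presents.{v, u} T) (hπ : IsUnitaryRep π)
    (hred : H2IsReduced π) : ∃ c : ℝ, 0 < c ∧ HasGap T π c := by
  classical
  let ext : (PiLp 2 fun _ : T => E) → Γ → E := fun x g => if h : g ∈ T then x ⟨g, h⟩ else 0
  have hext : ∀ x g (h : g ∈ T), ext x g = x ⟨g, h⟩ := fun x g h => dif_pos h
  have hext1 : ∀ x g (hg : g ∈ T) h (hh : h ∈ T) (hgh : g * h ∈ T),
      d1 π (ext x) (g, h) = truncD1 T π x ⟨(⟨g, hg⟩, ⟨h, hh⟩), hgh⟩ :=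
    fun x g hg h hh hgh => by
      simp only [d1, LinearMap.coe_mk, AddHom.coe_mk, hext x _ hg, hext x _ hh, hext x _ hgh,
        truncD1_apply]
  refine exists_gap_of_exact (truncD1_truncD0 T π) (fun x hx => ?_) ?_
  · let π' : Γ →* Module.End ℂ E :=
      { toFun := fun g => (π g : E →ₗ[ℂ] E)
        map_one' := by rw [map_one]; rfl
        map_mul' := fun g h => by rw [map_mul]; rfl }
    obtain ⟨β, hβ, hβT⟩ := hP.exists_cocycle π' (ext x) fun g hg h hh hgh => by
      have h1 := hext1 x g hg h hh hgh
      rw [hx] at h1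
      have h2 : π g (ext x h) - ext x (g * h) + ext x g = 0 := h1
      change ext x (g * h) = π g (ext x h) + ext x g
      rw [← sub_eq_zero, ← neg_eq_zero, ← h2]
      abel
    obtain ⟨v, hv⟩ := hT.exists_fixed_of_cocycle hπ (b := β) hβ
    refine ⟨-v, ?_⟩
    ext t
    have h1 := hv t
    rw [hβT t t.2, hext x t t.2] at h1
    rw [truncD0_apply, map_neg, eq_sub_of_add_eq' h1]
    abel
  · refine IsSeqClosed.isClosed fun y z hy hz => ?_
    choose x hx using hy
    let z' : Γ × Γ → E := fun p => if h : p.1 ∈ T ∧ p.2 ∈ T ∧ p.1 * p.2 ∈ T then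
      z ⟨(⟨p.1, h.1⟩, ⟨p.2, h.2.1⟩), h.2.2⟩ else 0
    have hz' : ∀ g (hg : g ∈ T) h (hh : h ∈ T) (hgh : g * h ∈ T),
        z' (g, h) = z ⟨(⟨g, hg⟩, ⟨h, hh⟩), hgh⟩ := fun g hg h hh hgh => dif_pos ⟨hg, hh, hgh⟩
    obtain ⟨c, hc⟩ := hP.exists_d1_eq_of_tendsto hred (b := fun n => ext (x n)) (z := z')
      fun g hg h hh hgh => by
        simp only [hext1 _ g hg h hh hgh, hz' g hg h hh hgh, hx]
        exact ((PiLp.proj (𝕜 := ℂ) 2 (fun _ : Triangle T => E) _).continuous.tendsto z).comp hz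
    refine ⟨WithLp.toLp 2 fun t => c t, ?_⟩
    ext ⟨⟨g, h⟩, hgh⟩
    have h1 := hc g g.2 h h.2 hgh
    rw [hz' g g.2 h h.2 hgh] at h1
    exact h1

/-- The gap passes to subrepresentations. -/
theorem HasGap.of_isometry (hπ : IsUnitaryRep π) {E' : Type*} [NormedAddCommGroup E']
    [InnerProductSpace ℂ E'] [CompleteSpace E'] {π' : Γ →* (E' →L[ℂ] E')} (hπ' : IsUnitaryRep π')
    (j : E →ₗᵢ[ℂ] E') (hj : ∀ g x, j (π g x) = π' g (j x)) {c : ℝ} (h : HasGap T π' c) :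
    HasGap T π c := by
  intro x
  have hnorm : ∀ {ι : Type v} [Fintype ι] (y : PiLp 2 fun _ : ι => E),
      ‖(WithLp.toLp 2 fun i => j (y i) : PiLp 2 fun _ : ι => E')‖ = ‖y‖ := fun y => by
    simp [PiLp.norm_eq_of_L2]
  have h1 := h (WithLp.toLp 2 fun t => j (x t))
  have h2 : truncD1 T π' (WithLp.toLp 2 fun t => j (x t)) =
      WithLp.toLp 2 fun p => j (truncD1 T π x p) := by
    ext p
    simp [hj]
  rw [hπ'.adjoint_truncD0_apply, h2, hnorm, hnorm] at h1
  rw [hπ.adjoint_truncD0_apply]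
  have h3 : ∑ t : T, (π' (t : Γ)⁻¹ (j (x t)) - j (x t)) =
      j (∑ t : T, (π (t : Γ)⁻¹ (x t) - x t)) := by
    simp [hj]
  change _ ≤ ‖∑ t : T, (π' (t : Γ)⁻¹ (j (x t)) - j (x t))‖ + _ at h1
  rwa [h3, j.norm_map] at h1

/-- An affine action whose linear part is close to a representation with a gap has a fixed point. -/
theorem HasGap.hasFixedPoint {c : ℝ} (hc : 0 < c) (hgap : HasGap T π c)
    (hgen : Subgroup.closure (T : Set Γ) = ⊤) {δ : ℝ} (hδ : 0 ≤ δ)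
    (h0 : Fintype.card T * δ ≤ c / 4) (h1 : Fintype.card (Triangle T) * δ ≤ c / 4)
    {ρ : Γ →* (E →L[ℂ] E)} (hρ : ∀ t ∈ T, ‖π t - ρ t‖ ≤ δ) {α : Γ →* (E ≃ᵃ[ℂ] E)}
    (hα : HasLinearPart α ρ) : HasFixedPoint α := by
  have hmul : ∀ g h v, α (g * h) v = α g (α h v) := fun g h v => by
    rw [map_mul]
    rfl
  have hαv : ∀ g v, α g v = ρ g v + α g 0 := fun g v => by
    have := (α g).map_vadd 0 v
    rw [hα] at this
    simpa using this
  -- The translation part is a cocycle for ρ; if it is the coboundary of `v`, then `-v` is fixed.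
  obtain ⟨v, hv⟩ := exact_of_gap hc hgap ((norm_truncD0_sub_le hδ hρ).trans h0)
    ((norm_truncD1_sub_le hδ hρ).trans h1) (truncD1_truncD0 T ρ)
    (x := WithLp.toLp 2 fun t => α t 0) (by
      ext p
      have h2 : α (p.1.1 * p.1.2) 0 = ρ p.1.1 (α p.1.2 0) + α p.1.1 0 := by
        rw [hmul, ← hαv]
      simp only [truncD1_apply, h2, PiLp.zero_apply]
      abel)
  refine ⟨-v, fun g => ?_⟩
  have hg : g ∈ Subgroup.closure (T : Set Γ) := hgen ▸ Subgroup.mem_top g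
  induction hg using Subgroup.closure_induction with
  | mem g hg =>
    have h2 : ρ g v - v = α g 0 := congrArg (fun x : PiLp 2 fun _ : T => E => x ⟨g, hg⟩) hv
    rw [hαv, ← h2, map_neg]
    abel
  | one => simp
  | mul g h _ _ ihg ihh =>
    rw [hmul, ihh, ihg]
  | inv g _ ih =>
    conv_lhs => rw [← ih]
    rw [← hmul, inv_mul_cancel, map_one]
    rfl

end Truncated

/-! ### From closeness on generators to closeness on a finite set -/

section Deformation

variable {Γ : Type v} [Group Γ]

theorem IsUnitaryRep.norm_le_one {E : Type u} [NormedAddCommGroup E] [InnerProductSpace ℂ E]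
    [CompleteSpace E] {π : Γ →* (E →L[ℂ] E)} (hπ : IsUnitaryRep π) (g : Γ) : ‖π g‖ ≤ 1 :=
  ContinuousLinearMap.opNorm_le_bound _ zero_le_one fun x => by rw [hπ.norm_map, one_mul]

/-- Deformations which are small on a generating set are small at every group element, uniformly in
the unitary representation. -/
theorem exists_isDeformation_norm_sub_le {S : Set Γ} (hS : Subgroup.closure S = ⊤) (g : Γ) :
    ∀ δ : ℝ, 0 < δ → ∃ ε : ℝ, 0 < ε ∧
      ∀ (E : Type u) [NormedAddCommGroup E] [InnerProductSpace ℂ E] [CompleteSpace E]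
        (π ρ : Γ →* (E →L[ℂ] E)), IsUnitaryRep π → IsDeformation S ε π ρ → ‖π g - ρ g‖ ≤ δ := by
  have hg : g ∈ Subgroup.closure S := hS ▸ Subgroup.mem_top g
  induction hg using Subgroup.closure_induction with
  | mem g hg => exact fun δ hδ => ⟨δ, hδ, fun E _ _ _ π ρ _ h => h g hg⟩
  | one => exact fun δ hδ => ⟨1, one_pos, fun E _ _ _ π ρ _ _ => by simpa using hδ.le⟩
  | mul g h _ _ ihg ihh =>
    intro δ hδ
    obtain ⟨ε₁, hε₁, h1⟩ := ihg (min 1 (δ / 3)) (by positivity)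
    obtain ⟨ε₂, hε₂, h2⟩ := ihh (min 1 (δ / 3)) (by positivity)
    refine ⟨min ε₁ ε₂, lt_min hε₁ hε₂, fun E _ _ _ π ρ hπ hρ => ?_⟩
    have d1 := h1 E π ρ hπ fun s hs => (hρ s hs).trans (min_le_left _ _)
    have d2 := h2 E π ρ hπ fun s hs => (hρ s hs).trans (min_le_right _ _)
    -- Expanding around π leaves only unitary factors and small differences; the norm of ρ never
    -- enters.
    have e : π (g * h) - ρ (g * h) =
        (π g - ρ g) * π h + (π g * (π h - ρ h) - (π g - ρ g) * (π h - ρ h)) := by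
      rw [map_mul, map_mul]
      noncomm_ring
    have n1 : ‖(π g - ρ g) * π h‖ ≤ δ / 3 * 1 := (norm_mul_le _ _).trans
      (mul_le_mul (d1.trans (min_le_right _ _)) (hπ.norm_le_one h) (norm_nonneg _) (by positivity))
    have n2 : ‖π g * (π h - ρ h)‖ ≤ 1 * (δ / 3) := (norm_mul_le _ _).trans
      (mul_le_mul (hπ.norm_le_one g) (d2.trans (min_le_right _ _)) (norm_nonneg _) zero_le_one)
    have n3 : ‖(π g - ρ g) * (π h - ρ h)‖ ≤ 1 * (δ / 3) := (norm_mul_le _ _).trans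
      (mul_le_mul (d1.trans (min_le_left _ _)) (d2.trans (min_le_right _ _)) (norm_nonneg _)
        zero_le_one)
    rw [e]
    refine (norm_add_le _ _).trans ?_
    linarith [norm_sub_le (π g * (π h - ρ h)) ((π g - ρ g) * (π h - ρ h))]
  | inv g _ ih =>
    intro δ hδ
    obtain ⟨ε, hε, h1⟩ := ih (min (1 / 2) (δ / 2)) (by positivity)
    refine ⟨ε, hε, fun E _ _ _ π ρ hπ hρ => ?_⟩
    have d := h1 E π ρ hπ hρ
    -- There is no a priori bound on `ρ g⁻¹`: the unknown difference recurs on the right with factor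
    -- at most 1/2 and is absorbed.
    have e : π g⁻¹ - ρ g⁻¹ = (π g⁻¹ - ρ g⁻¹) * ((π g - ρ g) * π g⁻¹) -
        π g⁻¹ * ((π g - ρ g) * π g⁻¹) := by
      have e1 : π g * π g⁻¹ = 1 := by rw [← map_mul, mul_inv_cancel, map_one]
      have e2 : ρ g⁻¹ * ρ g = 1 := by rw [← map_mul, inv_mul_cancel, map_one]
      rw [← sub_mul, sub_sub_cancel_left, sub_mul, e1, mul_sub, mul_one, ← mul_assoc, neg_mul, e2]
      noncomm_ring
    have n0 : ‖(π g - ρ g) * π g⁻¹‖ ≤ min (1 / 2) (δ / 2) := by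
      refine (norm_mul_le _ _).trans ((mul_le_of_le_one_right (norm_nonneg _) ?_).trans d)
      exact hπ.norm_le_one _
    have n1 : ‖(π g⁻¹ - ρ g⁻¹) * ((π g - ρ g) * π g⁻¹)‖ ≤ ‖π g⁻¹ - ρ g⁻¹‖ * (1 / 2) :=
      (norm_mul_le _ _).trans (by gcongr; exact n0.trans (min_le_left _ _))
    have n2 : ‖π g⁻¹ * ((π g - ρ g) * π g⁻¹)‖ ≤ 1 * (δ / 2) := (norm_mul_le _ _).trans
      (mul_le_mul (hπ.norm_le_one _) (n0.trans (min_le_right _ _)) (norm_nonneg _) zero_le_one)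
    have n3 := norm_sub_le ((π g⁻¹ - ρ g⁻¹) * ((π g - ρ g) * π g⁻¹))
      (π g⁻¹ * ((π g - ρ g) * π g⁻¹))
    rw [← e] at n3
    linarith

theorem exists_isDeformation_forall_norm_sub_le {S : Set Γ} (hS : Subgroup.closure S = ⊤)
    (T : Finset Γ) {δ : ℝ} (hδ : 0 < δ) : ∃ ε : ℝ, 0 < ε ∧
      ∀ (E : Type u) [NormedAddCommGroup E] [InnerProductSpace ℂ E] [CompleteSpace E]
        (π ρ : Γ →* (E →L[ℂ] E)), IsUnitaryRep π → IsDeformation S ε π ρ →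
          ∀ t ∈ T, ‖π t - ρ t‖ ≤ δ := by
  classical
  induction T using Finset.induction_on with
  | empty => exact ⟨1, one_pos, fun E _ _ _ π ρ _ _ t ht => by simp at ht⟩
  | insert g T _ ih =>
    obtain ⟨ε₁, hε₁, h1⟩ := ih
    obtain ⟨ε₂, hε₂, h2⟩ := exists_isDeformation_norm_sub_le.{u, v} hS g δ hδ
    refine ⟨min ε₁ ε₂, lt_min hε₁ hε₂, fun E _ _ _ π ρ hπ hρ t ht => ?_⟩
    rcases Finset.mem_insert.1 ht with rfl | ht
    · exact h2 E π ρ hπ fun s hs => (hρ s hs).trans (min_le_right _ _)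
    · exact h1 E π ρ hπ (fun s hs => (hρ s hs).trans (min_le_left _ _)) t ht

theorem exists_hasFixedPoint_of_hasGap {S : Set Γ} (hS : Subgroup.closure S = ⊤) {T : Finset Γ}
    (hT : Subgroup.closure (T : Set Γ) = ⊤) {c : ℝ} (hc : 0 < c) : ∃ ε : ℝ, 0 < ε ∧
      ∀ (E : Type u) [NormedAddCommGroup E] [InnerProductSpace ℂ E] [CompleteSpace E]
        (π : Γ →* (E →L[ℂ] E)), IsUnitaryRep π → HasGap T π c →
          ∀ ρ : Γ →* (E →L[ℂ] E), IsDeformation S ε π ρ →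
            ∀ α : Γ →* (E ≃ᵃ[ℂ] E), HasLinearPart α ρ → HasFixedPoint α := by
  let m : ℝ := Fintype.card T + Fintype.card (Triangle T) + 1
  have hm : 0 < m := by positivity
  have hδ : 0 < c / 4 / m := by positivity
  have hle : ∀ a : ℝ, a ≤ m → a * (c / 4 / m) ≤ c / 4 := fun a ha => by
    rw [mul_div_left_comm]
    exact mul_le_of_le_one_right (by positivity) ((div_le_one hm).2 ha)
  obtain ⟨ε, hε, h⟩ := exists_isDeformation_forall_norm_sub_le.{u, v} hS T hδ
  refine ⟨ε, hε, fun E _ _ _ π hπ hgap ρ hρ α hα => ?_⟩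
  refine hgap.hasFixedPoint hc hT hδ.le (hle _ ?_) (hle _ ?_) (h E π ρ hπ hρ) hα
  · have : (0 : ℝ) ≤ Fintype.card (Triangle T) := by positivity
    simp only [m]
    linarith
  · have : (0 : ℝ) ≤ Fintype.card T := by positivity
    simp only [m]
    linarith

end Deformation

/-! ### Hilbert direct sums and uniformity of the gap -/

section DirectSum

variable {Γ : Type v} [Group Γ] {ι : Type*} {E : ι → Type*} [∀ i, NormedAddCommGroup (E i)]
  [∀ i, InnerProductSpace ℂ (E i)] [∀ i, CompleteSpace (E i)] {π : ∀ i, Γ →* (E i →L[ℂ] E i)}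

/-- The Hilbert direct sum of unitary representations. -/
noncomputable def directSumRep (hπ : ∀ i, IsUnitaryRep (π i)) :
    Γ →* (lp E 2 →L[ℂ] lp E 2) where
  toFun g := lp.mapCLM 2 (fun i => π i g) zero_le_one fun i => (hπ i).norm_le_one g
  map_one' := by
    ext x i
    simp
  map_mul' g h := by
    ext x i
    simp

theorem directSumRep_apply (hπ : ∀ i, IsUnitaryRep (π i)) (g : Γ) (x : lp E 2) (i : ι) :
    directSumRep hπ g x i = π i g (x i) := rfl

theorem isUnitaryRep_directSumRep (hπ : ∀ i, IsUnitaryRep (π i)) :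
    IsUnitaryRep (directSumRep hπ) := by
  refine isUnitaryRep_of_norm_map fun g x => ?_
  simp only [lp.norm_eq_tsum_rpow (p := 2) (by norm_num), directSumRep_apply, (hπ _).norm_map]

theorem HasGap.of_directSumRep (hπ : ∀ i, IsUnitaryRep (π i)) {T : Finset Γ} {c : ℝ}
    (h : HasGap T (directSumRep hπ) c) (i : ι) : HasGap T (π i) c := by
  classical
  refine h.of_isometry (hπ i) (isUnitaryRep_directSumRep hπ)
    ⟨lp.lsingle 2 i, fun x => lp.norm_single (by norm_num) i x⟩ fun g x => ?_
  ext k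
  rw [directSumRep_apply]
  change Pi.single i (π i g x) k = π k g (Pi.single (M := E) i x k)
  by_cases hk : k = i
  · subst hk
    simp
  · simp [hk]

end DirectSum

/-- Otherwise pick π_n without gap 1/(n + 1). Their Hilbert sum has some gap c > 0, which every
summand inherits, a contradiction for large n. -/
theorem exists_uniform_hasGap {Γ : Type v} [Group Γ] {T : Finset Γ}
    (hgap : ∀ (E : Type u) [NormedAddCommGroup E] [InnerProductSpace ℂ E] [CompleteSpace E]
      (π : Γ →* (E →L[ℂ] E)), IsUnitaryRep π → ∃ c : ℝ, 0 < c ∧ HasGap T π c) :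
    ∃ c : ℝ, 0 < c ∧
      ∀ (E : Type u) [NormedAddCommGroup E] [InnerProductSpace ℂ E] [CompleteSpace E]
        (π : Γ →* (E →L[ℂ] E)), IsUnitaryRep π → HasGap T π c := by
  by_contra! hcon
  have h := fun n : ℕ => hcon (1 / ((n : ℝ) + 1)) Nat.one_div_pos_of_nat
  choose E i₁ i₂ i₃ π hπ hno using h
  obtain ⟨c, hc, hgapc⟩ := hgap (lp E 2) (directSumRep hπ) (isUnitaryRep_directSumRep hπ)
  obtain ⟨n, hn⟩ := exists_nat_one_div_lt hc
  refine hno n fun x => ?_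
  exact (mul_le_mul_of_nonneg_right hn.le (norm_nonneg x)).trans (hgapc.of_directSumRep hπ n x)

end DeformT

theorem mainTheorem4 (Γ : Type v) [Group Γ] [Group.IsFinitelyPresented Γ]
    (S : Finset Γ) (hS : Subgroup.closure (S : Set Γ) = ⊤)
    (hT : DeformT.HasPropertyT.{u, v} Γ) :
    (∀ (E : Type u) [NormedAddCommGroup E] [InnerProductSpace ℂ E] [CompleteSpace E]
      (π : Γ →* (E →L[ℂ] E)), DeformT.IsUnitaryRep π → DeformT.H2IsReduced π →
      ∃ ε : ℝ, 0 < ε ∧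
        ∀ ρ : Γ →* (E →L[ℂ] E), DeformT.IsDeformation (S : Set Γ) ε π ρ →
          ∀ α : Γ →* (E ≃ᵃ[ℂ] E), DeformT.HasLinearPart α ρ → DeformT.HasFixedPoint α) ∧
    ((∀ (E : Type u) [NormedAddCommGroup E] [InnerProductSpace ℂ E] [CompleteSpace E]
      (π : Γ →* (E →L[ℂ] E)), DeformT.IsUnitaryRep π → DeformT.H2IsReduced π) →
      ∃ ε : ℝ, 0 < ε ∧
        ∀ (E : Type u) [NormedAddCommGroup E] [InnerProductSpace ℂ E] [CompleteSpace E]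
          (π : Γ →* (E →L[ℂ] E)), DeformT.IsUnitaryRep π →
          ∀ ρ : Γ →* (E →L[ℂ] E), DeformT.IsDeformation (S : Set Γ) ε π ρ →
            ∀ α : Γ →* (E ≃ᵃ[ℂ] E), DeformT.HasLinearPart α ρ → DeformT.HasFixedPoint α) := by
  obtain ⟨T, hP⟩ := DeformT.exists_presents.{v, u} Γ
  refine ⟨fun E _ _ _ π hπ hred => ?_, fun hred => ?_⟩
  · obtain ⟨c, hc, hgap⟩ := DeformT.exists_hasGap hT hP hπ hred
    obtain ⟨ε, hε, h⟩ := DeformT.exists_hasFixedPoint_of_hasGap.{u, v} hS hP.1 hc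
    exact ⟨ε, hε, h E π hπ hgap⟩
  · obtain ⟨c, hc, hgap⟩ := DeformT.exists_uniform_hasGap.{u, v} fun E _ _ _ π hπ =>
      DeformT.exists_hasGap hT hP hπ (hred E π hπ)
    obtain ⟨ε, hε, h⟩ := DeformT.exists_hasFixedPoint_of_hasGap.{u, v} hS hP.1 hc
    exact ⟨ε, hε, fun E _ _ _ π hπ => h E π hπ (hgap E π hπ)⟩
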